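/- Let \(\mathcal{X}\) and \(\hat{\mathcal{X}}\) be finite non-empty alphabets, let \(d:\mathcal{X}\times\hat{\mathcal{X}}\to[0,\infty)\), and let \(P_{XY}\) be a pmf on \(\mathcal{X}\times\mathcal{X}\) with \(\mathbb{P}\{X=Y\}=1\) and first marginal \(P_X\). All logarithms are to base \(2\) and \(|a|^+=\max\{0,a\}\). Let \(R\ge 0\) and \(\Delta\ge\Delta_{\min}:=\min_{\varphi:\mathcal{X}\to\hat{\mathcal{X}}}\mathbb{E}[d(X,\varphi(Y))]\). For \(n\ge1\) let \((X^n,Y^n)\) consist of \(n\) i.i.d. pairs with law \(P_{XY}\), and put \[p_{\mathrm c}(n,R,\Delta)=\max_{f_n,g_n}\mathbb{P}\Big\{\tfrac1n\sum_{i=1}^n d(X_i,\hat X_i)\le\Delta\Big\},\qquad \hat X^n=g_n(f_n(Y^n)),\] where the maximum is over all encoders \(f_n:\mathcal{X}^n\to\{1,\dots,\lfloor 2^{nR}\rfloor\}\) and decoders \(g_n:\{1,\dots,\lfloor 2^{nR}\rfloor\}\to\hat{\mathcal{X}}^n\). For a pmf \(Q_X\) on \(\mathcal{X}\) let \[R(Q_X,\Delta)=\min_{Q_{\hat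 X|X}:\ \mathbb{E}_Q[d(X,\hat X)]\le\Delta} I_Q(X;\hat X)\] be the standard rate-distortion function, the mutual information and the expectation being taken under \(Q_XQ_{\hat X|X}\); the minimum is attained whenever the constraint set is non-empty, and \(R(Q_X,\Delta)=+\infty\) otherwise. Then \(p_{\mathrm c}(n,R,\Delta)>0\) for all \(n\ge1\), the limit \[E(R,\Delta)=\lim_{n\to\infty}-\frac1n\log p_{\mathrm c}(n,R,\Delta)\] exists and is finite, and \[E(R,\Delta)=\min_{Q_X}\Big\{D(Q_X\|P_X)+|R(Q_X,\Delta)-R|^+\Big\},\] where the minimum, over all pmfs \(Q_X\) on \(\mathcal{X}\), is attained. Here \(D(Q_X\|P_X)=+\infty\) unless \(Q_X\) is absolutely continuous with respect to \(P_X\). -/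

import Mathlib

open Filter Topology

noncomputable section

namespace RemoteLossy

/-! Finite alphabets; a pmf on a finite alphabet `α` is an element of `stdSimplex ℝ α`.
All logarithms and exponentials are in base two. -/

/-- The per-letter distortion `(1/n) ∑ᵢ d(xᵢ, x̂ᵢ)` of two sequences of length `n`. -/
def avgDist {X Z : Type*} (d : X → Z → ℝ) {n : ℕ} (x : Fin n → X) (z : Fin n → Z) : ℝ :=
  (1 / (n : ℝ)) * ∑ i, d (x i) (z i)

/-- The number `⌊2^{nR}⌋` of messages of a code of block length `n` and rate `R`. -/
def numMessages (n : ℕ) (R : ℝ) : ℕ := ⌊(2 : ℝ) ^ ((n : ℝ) * R)⌋₊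

/-- The probability that the code `(f, g)` reconstructs the remote source `Xⁿ` from the encoded
observation `Yⁿ` within distortion `Δ`, where `(Xⁿ, Yⁿ)` is i.i.d. with joint pmf `P`. -/
def correctProb {X Y Z : Type*} [Fintype X] [Fintype Y] (P : X × Y → ℝ) (d : X → Z → ℝ) (Δ : ℝ)
    {n M : ℕ} (f : (Fin n → Y) → Fin M) (g : Fin M → (Fin n → Z)) : ℝ :=
  ∑ x : Fin n → X, ∑ y : Fin n → Y,
    if avgDist d x (g (f y)) ≤ Δ then ∏ i, P (x i, y i) else 0

/-- The maximal correct reconstruction probability over all encoders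
`f : Yⁿ → [2^{nR}]` and decoders `g : [2^{nR}] → Zⁿ` (finitely many pairs). -/
def maxCorrectProb {X Y Z : Type*} [Fintype X] [Fintype Y] (P : X × Y → ℝ) (d : X → Z → ℝ)
    (n : ℕ) (R Δ : ℝ) : ℝ :=
  ⨆ c : ((Fin n → Y) → Fin (numMessages n R)) × (Fin (numMessages n R) → (Fin n → Z)),
    correctProb P d Δ c.1 c.2

/-- `Δ_min`, the least expected distortion `E[d(X, φ(Y))]` over all maps `φ : Y → Z`. -/
def minDist {X Y Z : Type*} [Fintype X] [Fintype Y] (P : X × Y → ℝ) (d : X → Z → ℝ) : ℝ :=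
  ⨅ φ : Y → Z, ∑ x, ∑ y, P (x, y) * d x (φ y)

/-- The marginal pmf on the first coordinate. -/
def fstMarginal {X Y : Type*} [Fintype Y] (P : X × Y → ℝ) : X → ℝ := fun x => ∑ y, P (x, y)

/-- The marginal pmf on the second coordinate. -/
def sndMarginal {X Y : Type*} [Fintype X] (P : X × Y → ℝ) : Y → ℝ := fun y => ∑ x, P (x, y)

/-- The relative entropy `D(Q‖P)` of pmfs, in bits; it is `+∞` unless `Q ≪ P`. -/
def relEntropy {X : Type*} [Fintype X] (Q P : X → ℝ) : EReal :=
  if ∀ x, P x = 0 → Q x = 0 then ((∑ x, Q x * Real.logb 2 (Q x / P x) : ℝ) : EReal) else ⊤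

/-- The mutual information, in bits, of the two coordinates of a pair with joint pmf `W`. -/
def mutualInfo {X Z : Type*} [Fintype X] [Fintype Z] (W : X × Z → ℝ) : ℝ :=
  ∑ x, ∑ z, W (x, z) * Real.logb 2 (W (x, z) / (fstMarginal W x * sndMarginal W z))

/-- The joint pmf of input and output of the channel `V` with input pmf `Q`. -/
def jointPmf {X Z : Type*} (Q : X → ℝ) (V : X → Z → ℝ) : X × Z → ℝ := fun p => Q p.1 * V p.1 p.2

/-- The conditional pmfs `V = Q_{X̂|X}` whose expected distortion under `Q` is at most `Δ`. -/
def testChannels {X Z : Type*} [Fintype X] [Fintype Z] (Q : X → ℝ) (d : X → Z → ℝ) (Δ : ℝ) :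
    Set (X → Z → ℝ) :=
  {V | (∀ x, V x ∈ stdSimplex ℝ Z) ∧ ∑ x, ∑ z, jointPmf Q V (x, z) * d x z ≤ Δ}

/-- The rate-distortion function `R(Q, Δ)`, in bits; it is `+∞` if no conditional pmf meets
the distortion constraint. -/
def rateDist {X Z : Type*} [Fintype X] [Fintype Z] (Q : X → ℝ) (d : X → Z → ℝ) (Δ : ℝ) : EReal :=
  ⨅ V ∈ testChannels Q d Δ, ((mutualInfo (jointPmf Q V) : ℝ) : EReal)

end RemoteLossy

end

noncomputable section

namespace RemoteLossy

/-! As `P` lives on the diagonal, the encoder sees the source itself, and the claim is the exponent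
of correct decoding in ordinary lossy coding, obtained by the method of types. The minima over `Q`
and over test channels merge into one minimum of the continuous `jointExponent` over the compact set
`feasible` (`isLeast_jointExponent`), attained at some `W` with value `E`.

Converse (`correctProb_le`): if `x` is reconstructed by a codeword `c` within distortion `Δ`, their
joint type is feasible, so `E ≤ D + |I - R|⁺` bounds the probability of `x` by `2^(-nE) (2^(-nH(x))
+ 2^(-nR) 2^(-nH(x|c)))`. Summed over `x`, the first term is polynomial in `n`; so is `∑
2^(-nH(x|c))` for each of the at most `2^(nR)` codewords.

Achievability (`exists_le_correctProb`): for a joint type with information `I`, greedily chosen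
codewords cover a fraction of about `min(1, 2^(n(R - I)))` of the type class of the first marginal,
which has probability about `2^(-nD)`. Joint types tending to `W` inside `feasible`
(`exists_sequence_tendsto`) and continuity give the matching bound. -/

/-- The Shannon entropy of a pmf, in bits. -/
def entropy {A : Type*} [Fintype A] (q : A → ℝ) : ℝ := ∑ a, -(q a * Real.logb 2 (q a))

/-- The exponent `D(W_X‖p) + |I(W) - R|⁺` of a joint pmf `W`. -/
def jointExponent {X Z : Type*} [Fintype X] [Fintype Z] (p : X → ℝ) (R : ℝ) (W : X × Z → ℝ) : ℝ :=
  ∑ x, fstMarginal W x * Real.logb 2 (fstMarginal W x / p x) + max 0 (mutualInfo W - R)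

/-- The joint pmfs with first marginal dominated by `p` and expected distortion at most `Δ`. -/
def feasible {X Z : Type*} [Fintype X] [Fintype Z] (p : X → ℝ) (d : X → Z → ℝ) (Δ : ℝ) :
    Set (X × Z → ℝ) :=
  {W | W ∈ stdSimplex ℝ (X × Z) ∧ (∀ x, p x = 0 → fstMarginal W x = 0) ∧
    ∑ w, W w * d w.1 w.2 ≤ Δ}

/-! ### Single-letter side: continuity, compactness, and merging the two minima. -/

section

variable {A X Z : Type*} [Fintype A] [Fintype X] [Fintype Z]

set_option linter.unusedSectionVars false

theorem continuous_entropy : Continuous (entropy : (A → ℝ) → ℝ) := by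
  have h : (entropy : (A → ℝ) → ℝ) = fun q => ∑ a, Real.negMulLog (q a) / Real.log 2 := by
    funext q
    refine Finset.sum_congr rfl fun a _ => ?_
    simp only [Real.negMulLog, Real.logb]
    ring
  rw [h]
  have := Real.continuous_negMulLog
  fun_prop

theorem continuous_fstMarginal : Continuous (fstMarginal : (X × Z → ℝ) → X → ℝ) := by
  unfold fstMarginal
  fun_prop

theorem continuous_sndMarginal : Continuous (sndMarginal : (X × Z → ℝ) → Z → ℝ) := by
  unfold sndMarginal
  fun_prop

theorem fstMarginal_nonneg {W : X × Z → ℝ} (hW : ∀ w, 0 ≤ W w) (x : X) : 0 ≤ fstMarginal W x :=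
  Finset.sum_nonneg fun _ _ => hW _

theorem le_fstMarginal {W : X × Z → ℝ} (hW : ∀ w, 0 ≤ W w) (x : X) (z : Z) :
    W (x, z) ≤ fstMarginal W x :=
  Finset.single_le_sum (f := fun z => W (x, z)) (fun _ _ => hW _) (Finset.mem_univ z)

theorem le_sndMarginal {W : X × Z → ℝ} (hW : ∀ w, 0 ≤ W w) (x : X) (z : Z) :
    W (x, z) ≤ sndMarginal W z :=
  Finset.single_le_sum (f := fun x => W (x, z)) (fun _ _ => hW _) (Finset.mem_univ x)

theorem fstMarginal_mem_stdSimplex {W : X × Z → ℝ} (hW : W ∈ stdSimplex ℝ (X × Z)) :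
    fstMarginal W ∈ stdSimplex ℝ X := by
  refine ⟨fstMarginal_nonneg hW.1, ?_⟩
  rw [← hW.2, Fintype.sum_prod_type]
  rfl

/-- Cells of mass zero contribute nothing to either side; elsewhere the logarithm splits. This form
has no quotients, so it yields continuity up to the boundary, and it matches the sizes of type
classes. -/
theorem mutualInfo_eq_entropy {W : X × Z → ℝ} (hW : ∀ w, 0 ≤ W w) :
    mutualInfo W = entropy (fstMarginal W) + entropy (sndMarginal W) - entropy W := by
  have h1 : entropy (fstMarginal W) =
      ∑ x, ∑ z, -(W (x, z) * Real.logb 2 (fstMarginal W x)) := by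
    refine Finset.sum_congr rfl fun x _ => ?_
    rw [Finset.sum_neg_distrib, ← Finset.sum_mul]
    rfl
  have h2 : entropy (sndMarginal W) =
      ∑ x, ∑ z, -(W (x, z) * Real.logb 2 (sndMarginal W z)) := by
    rw [Finset.sum_comm]
    refine Finset.sum_congr rfl fun z _ => ?_
    rw [Finset.sum_neg_distrib, ← Finset.sum_mul]
    rfl
  rw [h1, h2, entropy, Fintype.sum_prod_type, ← Finset.sum_add_distrib, ← Finset.sum_sub_distrib]
  refine Finset.sum_congr rfl fun x _ => ?_
  rw [← Finset.sum_add_distrib, ← Finset.sum_sub_distrib]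
  refine Finset.sum_congr rfl fun z _ => ?_
  rcases (hW (x, z)).eq_or_lt with h | h
  · simp [← h]
  · have hx := h.trans_le (le_fstMarginal hW x z)
    have hz := h.trans_le (le_sndMarginal hW x z)
    rw [Real.logb_div h.ne' (mul_pos hx hz).ne', Real.logb_mul hx.ne' hz.ne']
    ring

theorem sum_mul_logb_div {q p : A → ℝ} (h : ∀ a, p a = 0 → q a = 0) :
    ∑ a, q a * Real.logb 2 (q a / p a) = -entropy q - ∑ a, q a * Real.logb 2 (p a) := by
  rw [entropy, ← Finset.sum_neg_distrib, ← Finset.sum_sub_distrib]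
  refine Finset.sum_congr rfl fun a _ => ?_
  by_cases hq : q a = 0
  · simp [hq]
  · rw [Real.logb_div hq (fun hp => hq (h a hp))]
    ring

theorem continuousOn_mutualInfo :
    ContinuousOn (mutualInfo : (X × Z → ℝ) → ℝ) {W | ∀ w, 0 ≤ W w} := by
  refine ContinuousOn.congr (f := fun W => entropy (fstMarginal W) + entropy (sndMarginal W)
    - entropy W) ?_ fun W hW => mutualInfo_eq_entropy hW
  exact (((continuous_entropy.comp continuous_fstMarginal).add
    (continuous_entropy.comp continuous_sndMarginal)).sub continuous_entropy).continuousOn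

/-- Domination by `p` lets the divergence be written as minus an entropy minus a term linear in `W`,
both continuous. -/
theorem continuousOn_jointExponent (p : X → ℝ) (d : X → Z → ℝ) (R Δ : ℝ) :
    ContinuousOn (jointExponent p R) (feasible p d Δ) := by
  refine ContinuousOn.add ?_ ?_
  · refine ContinuousOn.congr (f := fun W => -entropy (fstMarginal W) -
      ∑ x, fstMarginal W x * Real.logb 2 (p x)) ?_ fun W hW => sum_mul_logb_div hW.2.1
    have h1 := continuous_entropy.comp (continuous_fstMarginal (X := X) (Z := Z))
    have h2 : ∀ x, Continuous fun W : X × Z → ℝ => fstMarginal W x :=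
      continuous_pi_iff.1 continuous_fstMarginal
    exact (h1.neg.sub (continuous_finsetSum _ fun x _ => (h2 x).mul continuous_const)).continuousOn
  · exact continuousOn_const.sup ((continuousOn_mutualInfo.mono fun W hW => hW.1.1).sub
      continuousOn_const)

theorem isCompact_feasible (p : X → ℝ) (d : X → Z → ℝ) (Δ : ℝ) : IsCompact (feasible p d Δ) := by
  have h : ∀ x, Continuous fun W : X × Z → ℝ => fstMarginal W x :=
    continuous_pi_iff.1 continuous_fstMarginal
  have h1 : IsClosed {W : X × Z → ℝ | ∀ x, p x = 0 → fstMarginal W x = 0} := by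
    simp only [Set.ofPred_forall]
    exact isClosed_iInter fun x => isClosed_iInter fun _ => isClosed_eq (h x) continuous_const
  have h2 : IsClosed {W : X × Z → ℝ | ∑ w, W w * d w.1 w.2 ≤ Δ} :=
    isClosed_le (by fun_prop) continuous_const
  exact (isCompact_stdSimplex ℝ (X × Z)).inter_right (h1.inter h2)

theorem fstMarginal_jointPmf {Q : X → ℝ} {V : X → Z → ℝ} (hV : ∀ x, V x ∈ stdSimplex ℝ Z) :
    fstMarginal (jointPmf Q V) = Q := by
  funext x
  simp only [fstMarginal, jointPmf, ← Finset.mul_sum, (hV x).2, mul_one]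

theorem jointPmf_mem_stdSimplex {Q : X → ℝ} (hQ : Q ∈ stdSimplex ℝ X) {V : X → Z → ℝ}
    (hV : ∀ x, V x ∈ stdSimplex ℝ Z) : jointPmf Q V ∈ stdSimplex ℝ (X × Z) := by
  refine ⟨fun w => mul_nonneg (hQ.1 _) ((hV _).1 _), ?_⟩
  rw [Fintype.sum_prod_type, ← hQ.2]
  exact Finset.sum_congr rfl fun x _ => congrFun (fstMarginal_jointPmf hV) x

theorem jointPmf_mem_feasible {p Q : X → ℝ} (hQ : Q ∈ stdSimplex ℝ X) {d : X → Z → ℝ} {Δ : ℝ}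
    {V : X → Z → ℝ} (hV : V ∈ testChannels Q d Δ) (hp : ∀ x, p x = 0 → Q x = 0) :
    jointPmf Q V ∈ feasible p d Δ := by
  refine ⟨jointPmf_mem_stdSimplex hQ hV.1, ?_, ?_⟩
  · rwa [fstMarginal_jointPmf hV.1]
  · rw [Fintype.sum_prod_type]
    exact hV.2

theorem exists_jointPmf_eq [Nonempty Z] {W : X × Z → ℝ} (hW : ∀ w, 0 ≤ W w) :
    ∃ V : X → Z → ℝ, (∀ x, V x ∈ stdSimplex ℝ Z) ∧ jointPmf (fstMarginal W) V = W := by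
  classical
  obtain ⟨z₀⟩ := ‹Nonempty Z›
  -- Where the marginal vanishes the conditional pmf is arbitrary; a point mass serves.
  refine ⟨fun x => if fstMarginal W x = 0 then Pi.single z₀ 1 else
    fun z => W (x, z) / fstMarginal W x, fun x => ?_, ?_⟩
  · by_cases h : fstMarginal W x = 0
    · simpa only [h, if_true] using single_mem_stdSimplex ℝ z₀
    · simp only [h, if_false]
      refine ⟨fun z => div_nonneg (hW _) (fstMarginal_nonneg hW x), ?_⟩
      rw [← Finset.sum_div]
      exact div_self h
  · funext ⟨x, z⟩
    by_cases h : fstMarginal W x = 0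
    · have := le_antisymm ((le_fstMarginal hW x z).trans h.le) (hW _)
      simp [jointPmf, h, this]
    · simp only [jointPmf, h, if_false]
      field_simp

theorem exists_rateDist_eq {Q : X → ℝ} (hQ : Q ∈ stdSimplex ℝ X) (d : X → Z → ℝ) (Δ : ℝ)
    (hne : (testChannels Q d Δ).Nonempty) :
    ∃ V ∈ testChannels Q d Δ, rateDist Q d Δ = ((mutualInfo (jointPmf Q V) : ℝ) : EReal) := by
  have hcont : Continuous fun V : X → Z → ℝ => jointPmf Q V := by
    unfold jointPmf
    fun_prop
  have hcomp : IsCompact (testChannels Q d Δ) := by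
    have h1 : IsCompact (Set.univ.pi fun _ : X => stdSimplex ℝ Z) :=
      isCompact_univ_pi fun _ => isCompact_stdSimplex ℝ Z
    have h2 : IsClosed {V : X → Z → ℝ | ∑ x, ∑ z, jointPmf Q V (x, z) * d x z ≤ Δ} := by
      refine isClosed_le ?_ continuous_const
      unfold jointPmf
      fun_prop
    convert h1.inter_right h2 using 1
    ext V
    simp [testChannels]
  have hI : ContinuousOn (fun V => mutualInfo (jointPmf Q V)) (testChannels Q d Δ) :=
    continuousOn_mutualInfo.comp hcont.continuousOn
      fun V hV => (jointPmf_mem_stdSimplex hQ hV.1).1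
  obtain ⟨V, hV, hmin⟩ := hcomp.exists_isMinOn hne hI
  refine ⟨V, hV, le_antisymm (iInf₂_le V hV) (le_iInf₂ fun V' hV' => ?_)⟩
  exact_mod_cast hmin hV'

theorem relEntropy_add_eq_jointExponent {p Q : X → ℝ} {d : X → Z → ℝ} {Δ R : ℝ}
    {V : X → Z → ℝ} (hV : V ∈ testChannels Q d Δ) (hp : ∀ x, p x = 0 → Q x = 0)
    (h : rateDist Q d Δ = ((mutualInfo (jointPmf Q V) : ℝ) : EReal)) :
    relEntropy Q p + max 0 (rateDist Q d Δ - (R : EReal)) =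
      ((jointExponent p R (jointPmf Q V) : ℝ) : EReal) := by
  rw [relEntropy, if_pos hp, h, jointExponent, fstMarginal_jointPmf hV.1, EReal.coe_add,
    EReal.coe_strictMono.monotone.map_max, EReal.coe_sub, EReal.coe_zero]

/-- A pair (pmf, admissible test channel) with dominated pmf is the same as a feasible joint pmf, up
to the channel on null letters. All other `Q` have value `⊤`. -/
theorem isLeast_jointExponent [Nonempty Z] {p : X → ℝ} {d : X → Z → ℝ} {Δ R : ℝ}
    {W : X × Z → ℝ} (hW : W ∈ feasible p d Δ)
    (hmin : ∀ W' ∈ feasible p d Δ, jointExponent p R W ≤ jointExponent p R W') :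
    IsLeast ((fun Q : X → ℝ => relEntropy Q p + max 0 (rateDist Q d Δ - (R : EReal))) ''
      stdSimplex ℝ X) ((jointExponent p R W : ℝ) : EReal) := by
  have hlow : ∀ Q ∈ stdSimplex ℝ X, ((jointExponent p R W : ℝ) : EReal) ≤
      relEntropy Q p + max 0 (rateDist Q d Δ - (R : EReal)) := by
    intro Q hQ
    by_cases hp : ∀ x, p x = 0 → Q x = 0
    · rcases (testChannels Q d Δ).eq_empty_or_nonempty with he | hne
      · have : rateDist Q d Δ = ⊤ := by simp [rateDist, he]
        rw [this, relEntropy, if_pos hp, EReal.top_sub_coe, max_eq_right le_top,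
          EReal.coe_add_top]
        exact le_top
      · obtain ⟨V, hV, h⟩ := exists_rateDist_eq hQ d Δ hne
        rw [relEntropy_add_eq_jointExponent hV hp h]
        exact_mod_cast hmin _ (jointPmf_mem_feasible hQ hV hp)
    -- In `EReal`, `⊤ + ⊥ = ⊥`, so the second summand must be kept away from `⊥`.
    · rw [relEntropy, if_neg hp, EReal.top_add_of_ne_bot]
      · exact le_top
      · exact ne_bot_of_le_ne_bot EReal.zero_ne_bot (le_max_left _ _)
  refine ⟨⟨fstMarginal W, fstMarginal_mem_stdSimplex hW.1, ?_⟩, ?_⟩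
  · refine le_antisymm ?_ (hlow _ (fstMarginal_mem_stdSimplex hW.1))
    obtain ⟨V, hV, hVW⟩ := exists_jointPmf_eq hW.1.1
    have hVt : V ∈ testChannels (fstMarginal W) d Δ := by
      refine ⟨hV, ?_⟩
      rw [hVW, ← Fintype.sum_prod_type' (f := fun x z => W (x, z) * d x z)]
      exact hW.2.2
    have hle : rateDist (fstMarginal W) d Δ ≤ ((mutualInfo W : ℝ) : EReal) := by
      have := iInf₂_le (f := fun (V : X → Z → ℝ) (_ : V ∈ testChannels (fstMarginal W) d Δ) =>
        ((mutualInfo (jointPmf (fstMarginal W) V) : ℝ) : EReal)) V hVt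
      rwa [hVW] at this
    simp only [relEntropy, if_pos hW.2.1]
    rw [jointExponent, EReal.coe_add, EReal.coe_strictMono.monotone.map_max, EReal.coe_sub,
      EReal.coe_zero]
    exact add_le_add le_rfl (max_le_max le_rfl (EReal.sub_le_sub hle le_rfl))
  · rintro _ ⟨Q, hQ, rfl⟩
    exact hlow Q hQ

end

/-! ### Types: sizes of type classes and probabilities of sequences. -/

section Types

open scoped Classical Nat

variable {A : Type*} {n : ℕ}

/-- The number of occurrences of the letter `a` in the sequence `s`. -/
def count (s : Fin n → A) (a : A) : ℕ := Fintype.card {i // s i = a}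

/-- The empirical distribution of a sequence. -/
def empirical (s : Fin n → A) (a : A) : ℝ := count s a / n

theorem count_eq_card_filter (s : Fin n → A) (a : A) :
    count s a = (Finset.univ.filter fun i => s i = a).card :=
  Fintype.card_subtype _

theorem count_le (s : Fin n → A) (a : A) : count s a ≤ n :=
  (Fintype.card_subtype_le _).trans_eq (Fintype.card_fin n)

theorem exists_perm_of_count_eq {s t : Fin n → A} (h : count s = count t) :
    ∃ σ : Equiv.Perm (Fin n), s ∘ σ = t := by
  have e : ∀ a, {i // t i = a} ≃ {i // s i = a} := fun a =>
    Fintype.equivOfCardEq (congrFun h a).symm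
  exact ⟨Equiv.ofFiberEquiv e, funext fun i => Equiv.ofFiberEquiv_map e i⟩

theorem count_comp_perm (s : Fin n → A) (σ : Equiv.Perm (Fin n)) : count (s ∘ σ) = count s := by
  funext a
  exact Fintype.card_congr (σ.subtypeEquiv fun i => Iff.rfl)

theorem empirical_nonneg (s : Fin n → A) (a : A) : 0 ≤ empirical s a := by
  unfold empirical
  positivity

theorem empirical_apply_pos (s : Fin n → A) (i : Fin n) : 0 < empirical s (s i) := by
  have h1 : 0 < count s (s i) := Fintype.card_pos_iff.2 ⟨⟨i, rfl⟩⟩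
  have h2 : 0 < n := i.pos
  unfold empirical
  positivity

theorem exists_apply_eq_of_empirical_ne_zero {s : Fin n → A} {a : A} (h : empirical s a ≠ 0) :
    ∃ i, s i = a := by
  have : count s a ≠ 0 := fun h0 => h (by simp [empirical, h0])
  obtain ⟨i⟩ := Fintype.card_pos_iff.1 (Nat.pos_of_ne_zero this)
  exact ⟨i.1, i.2⟩

/-- The vector of letter counts, as an element of a finite type. -/
def countFin (s : Fin n → A) (a : A) : Fin (n + 1) := ⟨count s a, Nat.lt_succ_of_le (count_le s a)⟩

theorem countFin_eq_iff {s t : Fin n → A} : countFin s = countFin t ↔ count s = count t := by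
  simp only [funext_iff, countFin, Fin.mk.injEq]

variable [Fintype A]

/-- The set of all sequences with the same letter counts as `s`. -/
def typeClass (s : Fin n → A) : Finset (Fin n → A) :=
  Finset.univ.filter fun t => count t = count s

theorem mem_typeClass {s t : Fin n → A} : t ∈ typeClass s ↔ count t = count s := by
  simp [typeClass]

theorem sum_comp_eq_sum_count (s : Fin n → A) (u : A → ℝ) :
    ∑ i, u (s i) = ∑ a, (count s a : ℝ) * u a := by
  rw [← Finset.sum_fiberwise' Finset.univ s u]
  exact Finset.sum_congr rfl fun a _ => by
    rw [Finset.sum_const, nsmul_eq_mul, count_eq_card_filter]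

theorem prod_comp_eq_prod_count (s : Fin n → A) (q : A → ℝ) :
    ∏ i, q (s i) = ∏ a, q a ^ count s a := by
  rw [← Finset.prod_fiberwise' Finset.univ s q]
  exact Finset.prod_congr rfl fun a _ => by rw [Finset.prod_const, count_eq_card_filter]

theorem sum_count (s : Fin n → A) : ∑ a, count s a = n := by
  have := sum_comp_eq_sum_count s fun _ => 1
  simp only [Finset.sum_const, Finset.card_univ, Fintype.card_fin, nsmul_eq_mul, mul_one] at this
  exact_mod_cast this.symm

theorem sum_comp_eq_mul_sum_empirical (s : Fin n → A) (u : A → ℝ) :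
    ∑ i, u (s i) = n * ∑ a, empirical s a * u a := by
  rw [sum_comp_eq_sum_count, Finset.mul_sum]
  rcases Nat.eq_zero_or_pos n with rfl | hn
  · refine Finset.sum_congr rfl fun a _ => ?_
    simp [Nat.le_zero.1 (count_le s a)]
  · refine Finset.sum_congr rfl fun a _ => ?_
    unfold empirical
    field_simp

theorem empirical_mem_stdSimplex (hn : n ≠ 0) (s : Fin n → A) :
    empirical s ∈ stdSimplex ℝ A := by
  refine ⟨empirical_nonneg s, ?_⟩
  simp only [empirical]
  rw [← Finset.sum_div, ← Nat.cast_sum, sum_count]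
  exact div_self (Nat.cast_ne_zero.2 hn)

theorem prod_comp_eq_two_rpow (s : Fin n → A) {q : A → ℝ} (hq : ∀ i, 0 < q (s i)) :
    ∏ i, q (s i) = 2 ^ ((n : ℝ) * ∑ a, empirical s a * Real.logb 2 (q a)) := by
  rw [← sum_comp_eq_mul_sum_empirical s fun a => Real.logb 2 (q a),
    Real.rpow_sum_of_pos two_pos]
  exact Finset.prod_congr rfl fun i _ =>
    (Real.rpow_logb two_pos (by norm_num) (hq i)).symm

theorem prod_empirical (s : Fin n → A) :
    ∏ i, empirical s (s i) = 2 ^ (-((n : ℝ) * entropy (empirical s))) := by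
  rw [prod_comp_eq_two_rpow s (empirical_apply_pos s), entropy, Finset.sum_neg_distrib, mul_neg,
    neg_neg]

/-- Orbit-stabilizer: the permutations carrying `s` to a given member of its class form a coset of
the stabilizer, whose order is the product of the factorials. -/
theorem card_typeClass_mul (s : Fin n → A) :
    (typeClass s).card * ∏ a, (count s a)! = n ! := by
  have h1 : Fintype.card (Equiv.Perm (Fin n)) = n ! := by simp [Fintype.card_perm]
  rw [← h1, ← Finset.card_univ, Finset.card_eq_sum_card_fiberwise (t := typeClass s)
    (f := fun σ : Equiv.Perm (Fin n) => s ∘ σ)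
    fun σ _ => mem_typeClass.2 (count_comp_perm s σ), ← smul_eq_mul, ← Finset.sum_const]
  refine Finset.sum_congr rfl fun t ht => ?_
  obtain ⟨τ, rfl⟩ := exists_perm_of_count_eq (mem_typeClass.1 ht).symm
  unfold count
  rw [← DomMulAct.stabilizer_card s, Fintype.card_subtype]
  refine Finset.card_bij (fun σ _ => σ * τ) ?_ ?_ ?_
  · intro σ hσ
    simp only [Finset.mem_filter, Finset.mem_univ, true_and] at hσ ⊢
    rw [Equiv.Perm.coe_mul, ← Function.comp_assoc, hσ]
  · intro σ _ σ' _ h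
    exact mul_right_cancel h
  · intro σ hσ
    simp only [Finset.mem_filter, Finset.mem_univ, true_and] at hσ ⊢
    refine ⟨σ * τ⁻¹, ?_, by simp⟩
    rw [Equiv.Perm.coe_mul, ← Function.comp_assoc, hσ, Function.comp_assoc, ← Equiv.Perm.coe_mul]
    simp

theorem factorial_mul_pow_le (k j : ℕ) : k ! * k ^ j ≤ j ! * k ^ k := by
  rcases le_total k j with h | h
  · calc k ! * k ^ j = k ! * k ^ (j - k) * k ^ k := by
          rw [mul_assoc, ← pow_add, Nat.sub_add_cancel h]
      _ ≤ j ! * k ^ k := Nat.mul_le_mul_right _ (Nat.factorial_mul_pow_sub_le_factorial h)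
  · obtain ⟨m, rfl⟩ := Nat.exists_eq_add_of_le h
    calc (j + m)! * (j + m) ^ j ≤ (j ! * (j + m) ^ m) * (j + m) ^ j := by
          rw [← Nat.factorial_mul_ascFactorial]
          gcongr
          exact Nat.ascFactorial_le_pow_add j m
      _ = j ! * (j + m) ^ (j + m) := by rw [mul_assoc, ← pow_add, add_comm m j]

/-- With denominators `n ^ n` cleared: under the i.i.d. law `empirical s`, no type class is more
probable than that of `s`. Letter by letter this is `factorial_mul_pow_le`. -/
theorem card_typeClass_mul_pow_le (s t : Fin n → A) :
    (typeClass t).card * ∏ a, count s a ^ count t a ≤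
      (typeClass s).card * ∏ a, count s a ^ count s a := by
  have hpos : 0 < (∏ a, (count s a)!) * ∏ a, (count t a)! :=
    Nat.mul_pos (Finset.prod_pos fun _ _ => Nat.factorial_pos _)
      (Finset.prod_pos fun _ _ => Nat.factorial_pos _)
  have hle : (∏ a, (count s a)!) * ∏ a, count s a ^ count t a ≤
      (∏ a, (count t a)!) * ∏ a, count s a ^ count s a := by
    rw [← Finset.prod_mul_distrib, ← Finset.prod_mul_distrib]
    exact Finset.prod_le_prod' fun a _ => factorial_mul_pow_le _ _
  refine Nat.le_of_mul_le_mul_right ?_ hpos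
  calc _ = ((typeClass t).card * ∏ a, (count t a)!) *
        ((∏ a, (count s a)!) * ∏ a, count s a ^ count t a) := by ring
    _ ≤ ((typeClass s).card * ∏ a, (count s a)!) *
        ((∏ a, (count t a)!) * ∏ a, count s a ^ count s a) := by
      rw [card_typeClass_mul, card_typeClass_mul]
      exact Nat.mul_le_mul_left _ hle
    _ = _ := by ring

/-- The i.i.d. law `empirical s` has total mass 1, spread over at most `(n + 1) ^ |A|` classes, of
which the class of `s` is the heaviest. -/
theorem one_le_card_typeClass_mul (s : Fin n → A) :
    1 ≤ ((n : ℝ) + 1) ^ Fintype.card A *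
      ((typeClass s).card * 2 ^ (-((n : ℝ) * entropy (empirical s)))) := by
  rw [← prod_empirical]
  rcases Nat.eq_zero_or_pos n with rfl | hn
  · have : 0 < (typeClass s).card := Finset.card_pos.2 ⟨s, mem_typeClass.2 rfl⟩
    simpa using (Nat.one_le_cast (α := ℝ)).2 this
  have hq : ∀ t : Fin n → A, ∏ i, empirical s (t i) =
      ((∏ a, count s a ^ count t a : ℕ) : ℝ) / n ^ n := by
    intro t
    rw [prod_comp_eq_prod_count]
    simp only [empirical, div_pow]
    rw [Finset.prod_div_distrib, Finset.prod_pow_eq_pow_sum, sum_count]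
    push_cast
    rfl
  have h1 : ∑ t : Fin n → A, ∏ i, empirical s (t i) = 1 := by
    rw [← Fintype.sum_pow, (empirical_mem_stdSimplex hn.ne' s).2, one_pow]
  have hfib : ∀ k : A → Fin (n + 1),
      ∑ t ∈ Finset.univ.filter (fun t : Fin n → A => countFin t = k), ∏ i, empirical s (t i) ≤
        (typeClass s).card * ∏ i, empirical s (s i) := by
    intro k
    rcases (Finset.univ.filter fun t : Fin n → A => countFin t = k).eq_empty_or_nonempty
      with he | ⟨t, ht⟩
    · rw [he, Finset.sum_empty]
      exact mul_nonneg (Nat.cast_nonneg _) (Finset.prod_nonneg fun i _ => empirical_nonneg s _)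
    · have ht' : countFin t = k := (Finset.mem_filter.1 ht).2
      have hset : (Finset.univ.filter fun t : Fin n → A => countFin t = k) = typeClass t := by
        ext t'
        simp [mem_typeClass, ← ht', countFin_eq_iff]
      have hconst : ∀ t' ∈ typeClass t, ∏ i, empirical s (t' i) =
          ((∏ a, count s a ^ count t a : ℕ) : ℝ) / n ^ n := fun t' h => by
        rw [hq, mem_typeClass.1 h]
      rw [hset, Finset.sum_congr rfl hconst, Finset.sum_const, nsmul_eq_mul, hq, ← mul_div_assoc,
        ← mul_div_assoc]
      refine div_le_div_of_nonneg_right ?_ (by positivity)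
      exact_mod_cast card_typeClass_mul_pow_le s t
  refine h1.ge.trans ?_
  rw [← Finset.sum_fiberwise Finset.univ countFin]
  refine (Finset.sum_le_card_nsmul _ _ _ fun k _ => hfib k).trans_eq ?_
  simp [nsmul_eq_mul]

/-- Under its own empirical law the class has mass at most 1, and each member has mass `2^(-nH)`. -/
theorem card_typeClass_le (s : Fin n → A) :
    ((typeClass s).card : ℝ) ≤ 2 ^ ((n : ℝ) * entropy (empirical s)) := by
  rcases Nat.eq_zero_or_pos n with rfl | hn
  · have : (typeClass s).card ≤ 1 := Finset.card_le_one_of_subsingleton _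
    simpa using this
  have h1 : ∑ t : Fin n → A, ∏ i, empirical s (t i) = 1 := by
    rw [← Fintype.sum_pow, (empirical_mem_stdSimplex hn.ne' s).2, one_pow]
  have h2 : ∑ t ∈ typeClass s, ∏ i, empirical s (t i) ≤ 1 := by
    rw [← h1]
    exact Finset.sum_le_sum_of_subset_of_nonneg (Finset.subset_univ _)
      fun t _ _ => Finset.prod_nonneg fun i _ => empirical_nonneg s _
  have hconst : ∀ t ∈ typeClass s, ∏ i, empirical s (t i) = ∏ i, empirical s (s i) :=
    fun t h => by rw [prod_comp_eq_prod_count, prod_comp_eq_prod_count, mem_typeClass.1 h]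
  rw [Finset.sum_congr rfl hconst, Finset.sum_const, nsmul_eq_mul, prod_empirical,
    Real.rpow_neg two_pos.le] at h2
  exact (mul_inv_le_iff₀ (Real.rpow_pos_of_pos two_pos _)).1 h2 |>.trans_eq (one_mul _)

theorem exists_count_eq (k : A → ℕ) (hk : ∑ a, k a = n) : ∃ s : Fin n → A, count s = k := by
  have e : Fin n ≃ Σ a, Fin (k a) := Fintype.equivOfCardEq (by simp [hk])
  refine ⟨fun i => (e i).1, funext fun a => ?_⟩
  have e' : {i // (e i).1 = a} ≃ Fin (k a) :=
    (e.subtypeEquiv fun _ => Iff.rfl).trans (Equiv.sigmaSubtype a)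
  exact (Fintype.card_congr e').trans (Fintype.card_fin _)

theorem fstMarginal_empirical {X Z : Type*} [Fintype X] [Fintype Z] (s : Fin n → X × Z) :
    fstMarginal (empirical s) = empirical fun i => (s i).1 := by
  funext x
  simp only [fstMarginal, empirical]
  rw [← Finset.sum_div, ← Nat.cast_sum, count_eq_card_filter (fun i => (s i).1),
    Finset.card_eq_sum_card_fiberwise (t := Finset.univ) (f := fun i => (s i).2)
      fun _ _ => Finset.mem_coe.2 (Finset.mem_univ _)]
  simp only [count_eq_card_filter, Finset.filter_filter, Prod.ext_iff]

theorem sndMarginal_empirical {X Z : Type*} [Fintype X] [Fintype Z] (s : Fin n → X × Z) :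
    sndMarginal (empirical s) = empirical fun i => (s i).2 := by
  funext z
  simp only [sndMarginal, empirical]
  rw [← Finset.sum_div, ← Nat.cast_sum, count_eq_card_filter (fun i => (s i).2),
    Finset.card_eq_sum_card_fiberwise (t := Finset.univ) (f := fun i => (s i).1)
      fun _ _ => Finset.mem_coe.2 (Finset.mem_univ _)]
  simp only [count_eq_card_filter, Finset.filter_filter, Prod.ext_iff, and_comm]

end Types

/-! ### Converse: upper bound on the probability of correct reconstruction. -/

section Converse

open scoped Classical

variable {X Z : Type*} [Fintype X] [Fintype Z] {n : ℕ}

set_option linter.unusedSectionVars false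

theorem eq_zero_of_diagonal [DecidableEq X] {P : X × X → ℝ} (hP : P ∈ stdSimplex ℝ (X × X))
    (hXY : ∑ p : X × X, (if p.1 = p.2 then P p else 0) = 1) {x y : X} (h : x ≠ y) :
    P (x, y) = 0 := by
  have h0 : ∑ p : X × X, (P p - if p.1 = p.2 then P p else 0) = 0 := by
    rw [Finset.sum_sub_distrib, hXY, hP.2, sub_self]
  have h1 := (Finset.sum_eq_zero_iff_of_nonneg fun p _ => by
    split_ifs
    · simp
    · simpa using hP.1 p).1 h0 (x, y) (Finset.mem_univ _)
  simpa [h] using h1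

theorem fstMarginal_of_diagonal {P : X × X → ℝ} (h : ∀ x y, x ≠ y → P (x, y) = 0) (x : X) :
    fstMarginal P x = P (x, x) :=
  Finset.sum_eq_single x (fun y _ hy => h x y hy.symm) (by simp)

theorem correctProb_of_diagonal {P : X × X → ℝ} (h : ∀ x y, x ≠ y → P (x, y) = 0)
    (d : X → Z → ℝ) (Δ : ℝ) {M : ℕ} (f : (Fin n → X) → Fin M) (g : Fin M → Fin n → Z) :
    correctProb P d Δ f g =
      ∑ x : Fin n → X, if avgDist d x (g (f x)) ≤ Δ then ∏ i, fstMarginal P (x i) else 0 := by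
  refine Finset.sum_congr rfl fun x _ => ?_
  rw [Finset.sum_eq_single x]
  · simp only [fstMarginal_of_diagonal h]
  · intro y _ hy
    obtain ⟨i, hi⟩ := Function.ne_iff.1 hy
    rw [Finset.prod_eq_zero (Finset.mem_univ i) (h _ _ hi.symm), ite_self]
  · simp

/-- On each fibre of `label` the weights form one fixed product of sub-pmfs, so the fibre sums to at
most 1. With types as labels this sums type-dependent probabilities at polynomial cost. -/
theorem sum_prod_le_card {κ : Type*} [Fintype κ] (label : (Fin n → X) → κ)
    (v : (Fin n → X) → Fin n → X → ℝ) (hlabel : ∀ t t', label t = label t' → v t = v t')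
    (h0 : ∀ t i a, 0 ≤ v t i a) (h1 : ∀ t i, ∑ a, v t i a ≤ 1) :
    ∑ x : Fin n → X, ∏ i, v x i (x i) ≤ Fintype.card κ := by
  rw [← Finset.sum_fiberwise Finset.univ label]
  refine (Finset.sum_le_card_nsmul _ _ 1 fun k _ => ?_).trans_eq (by simp)
  rcases (Finset.univ.filter fun t => label t = k).eq_empty_or_nonempty with he | ⟨t, ht⟩
  · rw [he, Finset.sum_empty]
    exact zero_le_one
  · have ht' := (Finset.mem_filter.1 ht).2
    calc ∑ x ∈ Finset.univ.filter (fun x => label x = k), ∏ i, v x i (x i)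
        = ∑ x ∈ Finset.univ.filter (fun x => label x = k), ∏ i, v t i (x i) :=
          Finset.sum_congr rfl fun x hx => by
            rw [hlabel x t ((Finset.mem_filter.1 hx).2.trans ht'.symm)]
      _ ≤ ∑ x : Fin n → X, ∏ i, v t i (x i) :=
          Finset.sum_le_sum_of_subset_of_nonneg (Finset.subset_univ _)
            fun x _ _ => Finset.prod_nonneg fun i _ => h0 _ _ _
      _ = ∏ i, ∑ a, v t i a := (Fintype.prod_sum _).symm
      _ ≤ 1 := Finset.prod_le_one (fun i _ => Finset.sum_nonneg fun a _ => h0 _ _ _)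
            fun i _ => h1 t i

theorem sum_two_rpow_neg_entropy_le (hn : n ≠ 0) :
    ∑ x : Fin n → X, (2 : ℝ) ^ (-((n : ℝ) * entropy (empirical x))) ≤
      ((n : ℝ) + 1) ^ Fintype.card X := by
  have := sum_prod_le_card (n := n) (X := X) countFin (fun t _ => empirical t)
    (fun t t' h => by
      funext i a
      simp only [empirical, countFin_eq_iff.1 h])
    (fun t _ => empirical_nonneg t) fun t _ => (empirical_mem_stdSimplex hn t).2.le
  simp only [prod_empirical] at this
  simpa using this

theorem sum_two_rpow_neg_condEntropy_le (c : Fin n → Z) :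
    ∑ x : Fin n → X, (2 : ℝ) ^ ((n : ℝ) * (entropy (empirical c) -
        entropy (empirical fun i => (x i, c i)))) ≤
      ((n : ℝ) + 1) ^ Fintype.card (X × Z) := by
  have := sum_prod_le_card (n := n) (X := X) (fun t => countFin fun i => (t i, c i))
    -- The conditional empirical law of the source letter given the codeword letter `c i`.
    (fun t i a => empirical (fun i => (t i, c i)) (a, c i) / empirical c (c i))
    (fun t t' h => by
      funext i a
      simp only [empirical, countFin_eq_iff.1 h])
    (fun t i a => div_nonneg (empirical_nonneg _ _) (empirical_nonneg _ _)) fun t i => by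
      rw [← Finset.sum_div]
      have := congrFun (sndMarginal_empirical fun i => (t i, c i)) (c i)
      simp only [sndMarginal] at this
      rw [this]
      exact div_self_le_one _
  have h2 : ∀ x : Fin n → X, ∏ i, empirical (fun i => (x i, c i)) (x i, c i) /
      empirical c (c i) = (2 : ℝ) ^ ((n : ℝ) * (entropy (empirical c) -
        entropy (empirical fun i => (x i, c i)))) := fun x => by
    rw [Finset.prod_div_distrib, prod_empirical fun i => (x i, c i), prod_empirical c,
      ← Real.rpow_sub two_pos]
    congr 1
    ring
  simp only [h2] at this
  simpa using this

theorem empirical_mem_feasible (hn : n ≠ 0) {p : X → ℝ} {d : X → Z → ℝ} {Δ : ℝ}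
    {x : Fin n → X} {c : Fin n → Z} (hp : ∀ i, p (x i) ≠ 0) (hd : avgDist d x c ≤ Δ) :
    empirical (fun i => (x i, c i)) ∈ feasible p d Δ := by
  refine ⟨empirical_mem_stdSimplex hn _, fun a ha => ?_, ?_⟩
  · rw [fstMarginal_empirical]
    by_contra h
    obtain ⟨i, hi⟩ := exists_apply_eq_of_empirical_ne_zero h
    exact hp i ((congrArg p hi).trans ha)
  · rw [avgDist, sum_comp_eq_mul_sum_empirical (fun i => (x i, c i)) fun w => d w.1 w.2] at hd
    have : (n : ℝ) ≠ 0 := Nat.cast_ne_zero.2 hn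
    rwa [← mul_assoc, one_div_mul_cancel this, one_mul] at hd

theorem prod_eq_two_rpow_relEntropy {p : X → ℝ} {x : Fin n → X} (hp : ∀ i, 0 < p (x i)) :
    ∏ i, p (x i) = 2 ^ (-((n : ℝ) * (∑ a, empirical x a * Real.logb 2 (empirical x a / p a) +
      entropy (empirical x)))) := by
  rw [prod_comp_eq_two_rpow x hp, sum_mul_logb_div]
  · congr 1
    ring
  · intro a ha
    by_contra h
    obtain ⟨i, hi⟩ := exists_apply_eq_of_empirical_ne_zero h
    exact (hp i).ne' (by rw [hi, ha])

/-- If `I ≤ R` then `E ≤ D` and the first summand suffices; otherwise `E ≤ D + I - R`, and `I - H(x)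
= H(c) - H(x,c)` gives the second. -/
theorem prod_le_of_avgDist_le (hn : n ≠ 0) {p : X → ℝ} {d : X → Z → ℝ} {R Δ E : ℝ}
    (hE : ∀ W ∈ feasible p d Δ, E ≤ jointExponent p R W) {x : Fin n → X} {c : Fin n → Z}
    (hp : ∀ i, 0 < p (x i)) (hd : avgDist d x c ≤ Δ) :
    ∏ i, p (x i) ≤ 2 ^ (-((n : ℝ) * E)) * (2 ^ (-((n : ℝ) * entropy (empirical x))) +
      2 ^ (-((n : ℝ) * R)) * 2 ^ ((n : ℝ) * (entropy (empirical c) -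
        entropy (empirical fun i => (x i, c i))))) := by
  have hE' := hE _ (empirical_mem_feasible hn (fun i => (hp i).ne') hd)
  have hI := mutualInfo_eq_entropy (empirical_nonneg fun i => (x i, c i))
  rw [jointExponent] at hE'
  rw [fstMarginal_empirical] at hE' hI
  rw [sndMarginal_empirical] at hI
  simp only at hE' hI
  set I := mutualInfo (empirical fun i => (x i, c i))
  set D := ∑ a, empirical x a * Real.logb 2 (empirical x a / p a)
  have hn0 : (0 : ℝ) ≤ n := Nat.cast_nonneg n
  have hmul := mul_le_mul_of_nonneg_left hE' hn0
  rw [prod_eq_two_rpow_relEntropy hp, ← Real.rpow_add two_pos, mul_add ((2 : ℝ) ^ _), ← Real.rpow_add two_pos,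
    ← Real.rpow_add two_pos]
  rcases le_total (I - R) 0 with h | h
  · rw [max_eq_left h] at hmul
    refine le_add_of_le_of_nonneg (Real.rpow_le_rpow_of_exponent_le one_le_two ?_) (by positivity)
    linarith
  · rw [max_eq_right h, hI] at hmul
    refine le_add_of_nonneg_of_le (by positivity) (Real.rpow_le_rpow_of_exponent_le one_le_two ?_)
    linarith

theorem correctProb_le {P : X × X → ℝ} (hP : ∀ w, 0 ≤ P w) (hdiag : ∀ x y, x ≠ y → P (x, y) = 0)
    (hn : n ≠ 0) {d : X → Z → ℝ} {R Δ E : ℝ}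
    (hE : ∀ W ∈ feasible (fstMarginal P) d Δ, E ≤ jointExponent (fstMarginal P) R W)
    {M : ℕ} (f : (Fin n → X) → Fin M) (g : Fin M → Fin n → Z) :
    correctProb P d Δ f g ≤ 2 ^ (-((n : ℝ) * E)) * (((n : ℝ) + 1) ^ Fintype.card X +
      2 ^ (-((n : ℝ) * R)) * (M * ((n : ℝ) + 1) ^ Fintype.card (X × Z))) := by
  set T : Fin M → (Fin n → X) → ℝ := fun m x =>
    2 ^ ((n : ℝ) * (entropy (empirical (g m)) - entropy (empirical fun i => (x i, g m i)))) with hT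
  have hTpos : ∀ m x, 0 ≤ T m x := fun m x => (Real.rpow_pos_of_pos two_pos _).le
  have hT1 : ∑ x, T (f x) x ≤ M * ((n : ℝ) + 1) ^ Fintype.card (X × Z) := by
    -- Summing over all messages removes the encoder at the price of the factor `M`.
    calc ∑ x, T (f x) x ≤ ∑ x, ∑ m, T m x := Finset.sum_le_sum fun x _ =>
          Finset.single_le_sum (f := fun m => T m x) (fun m _ => hTpos m x) (Finset.mem_univ _)
      _ = ∑ m, ∑ x, T m x := Finset.sum_comm
      _ ≤ _ := (Finset.sum_le_card_nsmul _ _ _ fun m _ =>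
          sum_two_rpow_neg_condEntropy_le (g m)).trans_eq (by simp [nsmul_eq_mul])
  rw [correctProb_of_diagonal hdiag]
  calc _ ≤ ∑ x : Fin n → X, (2 : ℝ) ^ (-((n : ℝ) * E)) *
        (2 ^ (-((n : ℝ) * entropy (empirical x))) + 2 ^ (-((n : ℝ) * R)) * T (f x) x) := by
        refine Finset.sum_le_sum fun x _ => ?_
        have hnn : (0 : ℝ) ≤ 2 ^ (-((n : ℝ) * E)) *
            (2 ^ (-((n : ℝ) * entropy (empirical x))) + 2 ^ (-((n : ℝ) * R)) * T (f x) x) := by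
          have := hTpos (f x) x
          positivity
        split_ifs with h
        · by_cases hp : ∀ i, 0 < fstMarginal P (x i)
          · exact prod_le_of_avgDist_le hn hE hp h
          · push Not at hp
            obtain ⟨i, hi⟩ := hp
            rw [Finset.prod_eq_zero (Finset.mem_univ i) (hi.antisymm (fstMarginal_nonneg hP _))]
            exact hnn
        · exact hnn
    _ = 2 ^ (-((n : ℝ) * E)) * (∑ x : Fin n → X, (2 : ℝ) ^ (-((n : ℝ) * entropy (empirical x))) +
        2 ^ (-((n : ℝ) * R)) * ∑ x, T (f x) x) := by
        rw [← Finset.mul_sum, Finset.sum_add_distrib, Finset.mul_sum (s := Finset.univ)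
          (a := (2 : ℝ) ^ (-((n : ℝ) * R)))]
    _ ≤ _ := by
        gcongr
        exact sum_two_rpow_neg_entropy_le hn

end Converse

/-! ### Achievability: covering a type class, and approximation by types. -/

section Achievability

open scoped Classical

set_option linter.unusedSectionVars false

/-- Bernoulli and `(1 - p)(1 + p) ≤ 1` give `(1 - p)^M ≤ 1 / (1 + Mp)`; then `1 / (1 + t) ≤ 1 -
min(1, t)/2`. -/
theorem one_sub_pow_le {p : ℝ} (h0 : 0 ≤ p) (h1 : p ≤ 1) (M : ℕ) :
    (1 - p) ^ M ≤ 1 - min 1 (M * p) / 2 := by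
  have hb : 1 + (M : ℝ) * p ≤ (1 + p) ^ M := one_add_mul_le_pow (by linarith) M
  have hprod : (1 - p) ^ M * (1 + p) ^ M ≤ 1 := by
    rw [← mul_pow]
    exact pow_le_one₀ (mul_nonneg (by linarith) (by linarith)) (by nlinarith)
  have hnn : 0 ≤ (1 - p) ^ M := pow_nonneg (by linarith) M
  have ht : 0 ≤ (M : ℝ) * p := by positivity
  have hmul : (1 - p) ^ M * (1 + M * p) ≤ 1 :=
    (mul_le_mul_of_nonneg_left hb hnn).trans hprod
  have hu1 : min 1 ((M : ℝ) * p) ≤ 1 := min_le_left _ _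
  have hu2 : min 1 ((M : ℝ) * p) ≤ M * p := min_le_right _ _
  refine le_of_mul_le_mul_right (hmul.trans ?_) (by linarith : 0 < 1 + (M : ℝ) * p)
  nlinarith

/-- Greedy covering: if every point of `S` is related to at least a fraction `p` of `B`, then some
`M` points leave at most a fraction `(1 - p) ^ M` of `S` uncovered. -/
theorem exists_covering {α β : Type*} (S : Finset α) (B : Finset β) (hB : B.Nonempty)
    (r : α → β → Prop) [∀ x, DecidablePred (r x)] {p : ℝ} (h1 : p ≤ 1)
    (h : ∀ x ∈ S, p * B.card ≤ (B.filter (r x)).card) (M : ℕ) :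
    ∃ c : Fin M → β, ((S.filter fun x => ∀ m, ¬ r x (c m)).card : ℝ) ≤ (1 - p) ^ M * S.card := by
  induction M with
  | zero => exact ⟨Fin.elim0, by simp⟩
  | succ M ih =>
    obtain ⟨c, hc⟩ := ih
    set U := S.filter fun x => ∀ m, ¬ r x (c m) with hU
    -- Double counting of related pairs: on average a point of `B` covers at least a fraction `p` of
    -- the uncovered set `U`, so some point does.
    have hsum : ∑ _z ∈ B, p * (U.card : ℝ) ≤ ∑ z ∈ B, ((U.filter fun x => r x z).card : ℝ) := by
      have : ∑ z ∈ B, (U.filter fun x => r x z).card = ∑ x ∈ U, (B.filter (r x)).card := by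
        simp only [Finset.card_filter]
        exact Finset.sum_comm
      rw [← Nat.cast_sum, this, Nat.cast_sum, Finset.sum_const, nsmul_eq_mul]
      calc (B.card : ℝ) * (p * U.card) = U.card • (p * B.card) := by rw [nsmul_eq_mul]; ring
        _ ≤ _ := Finset.card_nsmul_le_sum _ _ _ fun x hx => h x (Finset.mem_filter.1 hx).1
    obtain ⟨z, -, hz⟩ := Finset.exists_le_of_sum_le hB hsum
    refine ⟨Fin.cons z c, ?_⟩
    have hset : (S.filter fun x => ∀ m, ¬ r x ((Fin.cons z c : Fin (M + 1) → β) m)) =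
        U.filter fun x => ¬ r x z := by
      ext x
      simp only [hU, Finset.mem_filter, Fin.forall_fin_succ, Fin.cons_zero, Fin.cons_succ]
      tauto
    have hcard : ((U.filter fun x => r x z).card : ℝ) + (U.filter fun x => ¬ r x z).card = U.card := by
      exact_mod_cast Finset.card_filter_add_card_filter_not (s := U) fun x => r x z
    rw [hset]
    calc ((U.filter fun x => ¬ r x z).card : ℝ) ≤ (1 - p) * U.card := by linarith
      _ ≤ (1 - p) * ((1 - p) ^ M * S.card) := mul_le_mul_of_nonneg_left hc (by linarith)
      _ = (1 - p) ^ (M + 1) * S.card := by ring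

variable {X Z : Type*} [Fintype X] [Fintype Z] {n : ℕ}

theorem comp_mem_typeClass {A B : Type*} [Fintype A] [Fintype B] (u : A → B) {s t : Fin n → A}
    (h : t ∈ typeClass s) : (fun i => u (t i)) ∈ typeClass fun i => u (s i) := by
  obtain ⟨σ, rfl⟩ := exists_perm_of_count_eq (mem_typeClass.1 h).symm
  exact mem_typeClass.2 (count_comp_perm (fun i => u (s i)) σ)

/-- Permuting coordinates shows that every sequence in the class of the first marginal has equally
many partners in the joint class; the joint class is fibred over these sequences. -/
theorem card_conditional_typeClass_mul (s : Fin n → X × Z) {x : Fin n → X}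
    (hx : x ∈ typeClass fun i => (s i).1) :
    ((typeClass fun i => (s i).2).filter fun z => (fun i => (x i, z i)) ∈ typeClass s).card *
      (typeClass fun i => (s i).1).card = (typeClass s).card := by
  have hN : ∀ y ∈ typeClass fun i => (s i).1,
      ((typeClass s).filter fun t => (fun i => (t i).1) = y).card =
      ((typeClass fun i => (s i).2).filter fun z => (fun i => (x i, z i)) ∈ typeClass s).card := by
    intro y hy
    obtain ⟨σ, rfl⟩ := exists_perm_of_count_eq
      ((mem_typeClass.1 hy).trans (mem_typeClass.1 hx).symm)
    refine Finset.card_bij (fun t _ i => (t (σ i)).2) ?_ ?_ ?_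
    · intro t ht
      obtain ⟨ht, hty⟩ := Finset.mem_filter.1 ht
      have hσ : t ∘ σ ∈ typeClass s := by
        rw [mem_typeClass, count_comp_perm, mem_typeClass.1 ht]
      refine Finset.mem_filter.2 ⟨comp_mem_typeClass Prod.snd hσ, ?_⟩
      convert hσ using 1
      subst hty
      rfl
    · intro t ht t' ht' h
      have h1 := (Finset.mem_filter.1 ht).2.trans (Finset.mem_filter.1 ht').2.symm
      funext i
      refine Prod.ext (congrFun h1 i) ?_
      simpa using congrFun h (σ.symm i)
    · intro z hz
      obtain ⟨-, hz⟩ := Finset.mem_filter.1 hz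
      refine ⟨fun i => (y i, z (σ.symm i)), Finset.mem_filter.2 ⟨?_, rfl⟩, by simp⟩
      rw [mem_typeClass, ← mem_typeClass.1 hz, ← count_comp_perm _ σ]
      congr 1
      funext i
      simp
  rw [Finset.card_eq_sum_card_fiberwise (s := typeClass s) (f := fun t i => (t i).1)
    (t := typeClass fun i => (s i).1) fun t ht => comp_mem_typeClass Prod.fst ht,
    Finset.sum_congr rfl hN, Finset.sum_const, smul_eq_mul, mul_comm]

theorem two_rpow_neg_mutualInfo_le (s : Fin n → X × Z) :
    2 ^ (-((n : ℝ) * mutualInfo (empirical s))) ≤ ((n : ℝ) + 1) ^ Fintype.card (X × Z) *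
      ((typeClass s).card / ((typeClass fun i => (s i).1).card *
        (typeClass fun i => (s i).2).card)) := by
  have h1 := card_typeClass_le fun i => (s i).1
  have h2 := card_typeClass_le fun i => (s i).2
  have h3 := one_le_card_typeClass_mul s
  have p1 : (0 : ℝ) < (typeClass fun i => (s i).1).card :=
    Nat.cast_pos.2 (Finset.card_pos.2 ⟨_, mem_typeClass.2 rfl⟩)
  have p2 : (0 : ℝ) < (typeClass fun i => (s i).2).card :=
    Nat.cast_pos.2 (Finset.card_pos.2 ⟨_, mem_typeClass.2 rfl⟩)
  rw [mutualInfo_eq_entropy (empirical_nonneg s), fstMarginal_empirical, sndMarginal_empirical,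
    ← mul_div_assoc, le_div_iff₀ (mul_pos p1 p2)]
  set a := entropy (empirical fun i => (s i).1)
  set b := entropy (empirical fun i => (s i).2)
  set e := entropy (empirical s)
  calc (2 : ℝ) ^ (-((n : ℝ) * (a + b - e))) * ((typeClass fun i => (s i).1).card *
        (typeClass fun i => (s i).2).card)
      ≤ 2 ^ (-((n : ℝ) * (a + b - e))) * (2 ^ ((n : ℝ) * a) * 2 ^ ((n : ℝ) * b)) := by gcongr
    _ = 2 ^ ((n : ℝ) * e) * 1 := by
        rw [← Real.rpow_add two_pos, ← Real.rpow_add two_pos, mul_one]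
        congr 1
        ring
    _ ≤ 2 ^ ((n : ℝ) * e) * (((n : ℝ) + 1) ^ Fintype.card (X × Z) *
          ((typeClass s).card * 2 ^ (-((n : ℝ) * e)))) := by gcongr
    _ = (2 ^ ((n : ℝ) * e) * 2 ^ (-((n : ℝ) * e))) * (((n : ℝ) + 1) ^ Fintype.card (X × Z) *
          (typeClass s).card) := by ring
    _ = _ := by rw [← Real.rpow_add two_pos, add_neg_cancel, Real.rpow_zero, one_mul]

/-- For every joint type there is a code covering a large part of the type class of its first
marginal. -/
theorem exists_code_typeClass (s : Fin n → X × Z) {M : ℕ} (hM : 0 < M) :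
    ∃ (f : (Fin n → X) → Fin M) (g : Fin M → Fin n → Z),
      ((typeClass fun i => (s i).1).card : ℝ) * (min 1 (M * (2 ^ (-((n : ℝ) *
        mutualInfo (empirical s))) / ((n : ℝ) + 1) ^ Fintype.card (X × Z))) / 2) ≤
      ((typeClass fun i => (s i).1).filter fun x =>
        (fun i => (x i, g (f x) i)) ∈ typeClass s).card := by
  set S := typeClass fun i => (s i).1
  set B := typeClass fun i => (s i).2
  have hB : B.Nonempty := ⟨_, mem_typeClass.2 rfl⟩
  have hs : (fun i => (s i).1) ∈ S := mem_typeClass.2 rfl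
  have p1 : (0 : ℝ) < S.card := Nat.cast_pos.2 (Finset.card_pos.2 ⟨_, hs⟩)
  have p2 : (0 : ℝ) < B.card := Nat.cast_pos.2 (Finset.card_pos.2 hB)
  -- The fraction of `B` jointly of type `s` with a given `x ∈ S`, the same for all such `x`.
  set q : ℝ := (typeClass s).card / (S.card * B.card) with hq
  have hdeg : ∀ x ∈ S, q * B.card =
      ((B.filter fun z => (fun i => (x i, z i)) ∈ typeClass s).card : ℝ) := by
    intro x hx
    rw [hq, ← card_conditional_typeClass_mul s hx, Nat.cast_mul]
    field_simp
    exact mul_comm _ _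
  have hq0 : 0 ≤ q := by positivity
  have hq1 : q ≤ 1 := by
    refine le_of_mul_le_mul_right ?_ p2
    rw [hdeg _ hs, one_mul]
    exact Nat.cast_le.2 (Finset.card_filter_le _ _)
  obtain ⟨g, hg⟩ := exists_covering S B hB (fun x z => (fun i => (x i, z i)) ∈ typeClass s) hq1
    (fun x hx => (hdeg x hx).le) M
  -- The encoder sends a message whose codeword covers `x`, and message 0 if there is none.
  have hf : ∀ x : Fin n → X, ∃ m : Fin M, (∃ m', (fun i => (x i, g m' i)) ∈ typeClass s) →
      (fun i => (x i, g m i)) ∈ typeClass s := by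
    intro x
    by_cases hx : ∃ m', (fun i => (x i, g m' i)) ∈ typeClass s
    · exact ⟨hx.choose, fun _ => hx.choose_spec⟩
    · exact ⟨⟨0, hM⟩, fun h => absurd h hx⟩
  choose f hf using hf
  refine ⟨f, g, ?_⟩
  have hle : 2 ^ (-((n : ℝ) * mutualInfo (empirical s))) /
      ((n : ℝ) + 1) ^ Fintype.card (X × Z) ≤ q := by
    rw [div_le_iff₀' (by positivity)]
    exact two_rpow_neg_mutualInfo_le s
  have hmin : min 1 (M * (2 ^ (-((n : ℝ) * mutualInfo (empirical s))) /
      ((n : ℝ) + 1) ^ Fintype.card (X × Z))) ≤ min 1 (M * q) := by gcongr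
  have hpow := one_sub_pow_le hq0 hq1 M
  have hunc : ((S.filter fun x => ¬ (fun i => (x i, g (f x) i)) ∈ typeClass s).card : ℝ) ≤
      (1 - q) ^ M * S.card := by
    refine le_trans (Nat.cast_le.2 (Finset.card_le_card ?_)) hg
    intro x hx
    obtain ⟨hx, hx'⟩ := Finset.mem_filter.1 hx
    exact Finset.mem_filter.2 ⟨hx, fun m hm => hx' (hf x ⟨m, hm⟩)⟩
  have hcard : ((S.filter fun x => (fun i => (x i, g (f x) i)) ∈ typeClass s).card : ℝ) +
      (S.filter fun x => ¬ (fun i => (x i, g (f x) i)) ∈ typeClass s).card = S.card := by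
    exact_mod_cast Finset.card_filter_add_card_filter_not (s := S)
      fun x => (fun i => (x i, g (f x) i)) ∈ typeClass s
  nlinarith

theorem avgDist_eq_of_mem_typeClass {d : X → Z → ℝ} {s : Fin n → X × Z} {x : Fin n → X}
    {z : Fin n → Z} (h : (fun i => (x i, z i)) ∈ typeClass s) :
    avgDist d x z = avgDist d (fun i => (s i).1) fun i => (s i).2 := by
  have h1 := sum_comp_eq_sum_count (fun i => (x i, z i)) fun w => d w.1 w.2
  have h2 := sum_comp_eq_sum_count s fun w => d w.1 w.2
  rw [mem_typeClass.1 h] at h1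
  simp only [avgDist, h1, h2]

theorem exists_le_correctProb {P : X × X → ℝ} (hP : ∀ w, 0 ≤ P w)
    (hdiag : ∀ x y, x ≠ y → P (x, y) = 0) {d : X → Z → ℝ} {R Δ : ℝ} {s : Fin n → X × Z}
    (hp : ∀ i, 0 < fstMarginal P (s i).1)
    (hd : avgDist d (fun i => (s i).1) (fun i => (s i).2) ≤ Δ) {M : ℕ}
    (hM : 2 ^ ((n : ℝ) * R) / 2 ≤ (M : ℝ)) :
    ∃ (f : (Fin n → X) → Fin M) (g : Fin M → Fin n → Z),
      2 ^ (-((n : ℝ) * jointExponent (fstMarginal P) R (empirical s))) /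
        (4 * ((n : ℝ) + 1) ^ (Fintype.card X + Fintype.card (X × Z))) ≤
        correctProb P d Δ f g := by
  have hM0 : 0 < M := by
    have : (0 : ℝ) < M := lt_of_lt_of_le (by positivity) hM
    exact_mod_cast this
  obtain ⟨f, g, hfg⟩ := exists_code_typeClass s hM0
  refine ⟨f, g, ?_⟩
  set x₀ : Fin n → X := fun i => (s i).1 with hx₀
  set D := ∑ a, empirical x₀ a * Real.logb 2 (empirical x₀ a / fstMarginal P a) with hD
  set I := mutualInfo (empirical s) with hI
  set K : ℝ := ((n : ℝ) + 1) ^ Fintype.card (X × Z) with hK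
  set L : ℝ := ((n : ℝ) + 1) ^ Fintype.card X with hL
  have hn1 : (1 : ℝ) ≤ (n : ℝ) + 1 := by
    have : (0 : ℝ) ≤ n := Nat.cast_nonneg n
    linarith
  have hK1 : 1 ≤ K := one_le_pow₀ hn1
  have hL1 : 1 ≤ L := one_le_pow₀ hn1
  have hF : jointExponent (fstMarginal P) R (empirical s) = D + max 0 (I - R) := by
    rw [jointExponent, fstMarginal_empirical]
  have hprob : ((typeClass x₀).filter fun x => (fun i => (x i, g (f x) i)) ∈ typeClass s).card *
      ∏ i, fstMarginal P (x₀ i) ≤ correctProb P d Δ f g := by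
    rw [correctProb_of_diagonal hdiag, ← Finset.sum_filter]
    calc _ = ∑ x ∈ (typeClass x₀).filter fun x => (fun i => (x i, g (f x) i)) ∈ typeClass s,
          ∏ i, fstMarginal P (x i) := by
          rw [← nsmul_eq_mul, ← Finset.sum_const]
          refine Finset.sum_congr rfl fun x hx => ?_
          rw [prod_comp_eq_prod_count, prod_comp_eq_prod_count x,
            mem_typeClass.1 (Finset.mem_filter.1 hx).1]
      _ ≤ _ := by
          refine Finset.sum_le_sum_of_subset_of_nonneg (fun x hx => ?_)
            fun x _ _ => Finset.prod_nonneg fun i _ => fstMarginal_nonneg hP _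
          refine Finset.mem_filter.2 ⟨Finset.mem_univ _, ?_⟩
          rwa [avgDist_eq_of_mem_typeClass (Finset.mem_filter.1 hx).2]
  have hn0 : (0 : ℝ) ≤ n := Nat.cast_nonneg n
  -- This factor 2 is the loss in `M ≥ 2^(nR) / 2`; the covering loses another 2, whence the 4 in
  -- the bound.
  have hmin : 2 ^ (-((n : ℝ) * max 0 (I - R))) / (2 * K) ≤
      min 1 (M * (2 ^ (-((n : ℝ) * I)) / K)) := by
    refine le_min ?_ ?_
    · refine div_le_one_of_le₀ ?_ (by positivity)
      refine (Real.rpow_le_one_of_one_le_of_nonpos one_le_two ?_).trans (by linarith)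
      exact neg_nonpos.2 (mul_nonneg hn0 (le_max_left _ _))
    · calc 2 ^ (-((n : ℝ) * max 0 (I - R))) / (2 * K)
          ≤ 2 ^ ((n : ℝ) * R + -((n : ℝ) * I)) / (2 * K) := by
            refine div_le_div_of_nonneg_right ?_ (by positivity)
            refine Real.rpow_le_rpow_of_exponent_le one_le_two ?_
            have := mul_le_mul_of_nonneg_left (le_max_right 0 (I - R)) hn0
            linarith
        _ = 2 ^ ((n : ℝ) * R) / 2 * (2 ^ (-((n : ℝ) * I)) / K) := by
            rw [Real.rpow_add two_pos]
            ring
        _ ≤ _ := by gcongr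
  have hS := one_le_card_typeClass_mul x₀
  rw [prod_eq_two_rpow_relEntropy hp, mul_add, neg_add, Real.rpow_add two_pos] at hprob
  refine le_trans ?_ hprob
  rw [hF, pow_add, mul_add, neg_add, Real.rpow_add two_pos]
  set mn := min 1 ((M : ℝ) * (2 ^ (-((n : ℝ) * I)) / K))
  set a : ℝ := 2 ^ (-((n : ℝ) * D))
  set b : ℝ := 2 ^ (-((n : ℝ) * max 0 (I - R)))
  set e : ℝ := 2 ^ (-((n : ℝ) * entropy (empirical x₀)))
  have ha : 0 < a := by positivity
  have he : 0 < e := by positivity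
  have hb : 0 < b := by positivity
  calc a * b / (4 * (L * K)) = a * (b / (2 * K)) / (2 * L) * 1 := by
        field_simp
        norm_num
    _ ≤ a * mn / (2 * L) * (L * ((typeClass x₀).card * e)) := by gcongr
    _ = ((typeClass x₀).card * (mn / 2)) * (a * e) := by field_simp
    _ ≤ _ := by gcongr

/-- Rounding a pmf to a type of denominator `n`, without raising a given cost. -/
theorem exists_counts_tendsto {A : Type*} [Fintype A] {W : A → ℝ} (hW : W ∈ stdSimplex ℝ A)
    (u : A → ℝ) :
    ∃ k : ℕ → A → ℕ, (∀ n, ∑ a, k n a = n) ∧ (∀ n a, W a = 0 → k n a = 0) ∧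
      (∀ n, ∑ a, (k n a : ℝ) * u a ≤ n * ∑ a, W a * u a) ∧
      Tendsto (fun n a => (k n a : ℝ) / n) atTop (𝓝 W) := by
  have hne : (Finset.univ.filter fun a => W a ≠ 0).Nonempty := by
    by_contra h
    have h0 : ∀ a, W a = 0 := by simpa [Finset.filter_eq_empty_iff] using h
    have := hW.2
    simp [h0] at this
  -- The cheapest letter of the support takes the mass lost by rounding all others down, so the cost
  -- cannot rise.
  obtain ⟨a₀, ha₀, hmin⟩ := Finset.exists_min_image _ u hne
  have ha₀ : W a₀ ≠ 0 := (Finset.mem_filter.1 ha₀).2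
  set r : ℕ → A → ℕ := fun n a => ⌊(n : ℝ) * W a⌋₊ with hr
  have hrle : ∀ n a, (r n a : ℝ) ≤ n * W a := fun n a =>
    Nat.floor_le (mul_nonneg (Nat.cast_nonneg n) (hW.1 a))
  have hsplit : ∀ v : A → ℝ, ∑ a, v a = v a₀ + ∑ a ∈ Finset.univ.erase a₀, v a := fun v =>
    (Finset.add_sum_erase _ _ (Finset.mem_univ a₀)).symm
  have hrsum : ∀ n, ∑ a ∈ Finset.univ.erase a₀, r n a ≤ n := by
    intro n
    have h1 : ∑ a ∈ Finset.univ.erase a₀, (r n a : ℝ) ≤ ∑ a, (n : ℝ) * W a := by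
      rw [hsplit fun a => (n : ℝ) * W a]
      refine le_add_of_nonneg_of_le (mul_nonneg (Nat.cast_nonneg n) (hW.1 a₀))
        (Finset.sum_le_sum fun a _ => hrle n a)
    rw [← Finset.mul_sum, hW.2, mul_one] at h1
    exact_mod_cast h1
  set k : ℕ → A → ℕ := fun n a =>
    if a = a₀ then n - ∑ b ∈ Finset.univ.erase a₀, r n b else r n a with hk
  have hk₀ : ∀ n, k n a₀ = n - ∑ b ∈ Finset.univ.erase a₀, r n b := fun n => by simp [hk]
  have hk₁ : ∀ n, ∀ a ∈ Finset.univ.erase a₀, k n a = r n a := fun n a ha => by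
    simp [hk, Finset.ne_of_mem_erase ha]
  have hksum : ∀ n, ∑ a, k n a = n := fun n => by
    rw [← Finset.add_sum_erase _ _ (Finset.mem_univ a₀), hk₀, Finset.sum_congr rfl (hk₁ n)]
    exact Nat.sub_add_cancel (hrsum n)
  refine ⟨k, hksum, fun n a ha => ?_, fun n => ?_, ?_⟩
  · have : a ≠ a₀ := fun h => ha₀ (h ▸ ha)
    simp [hk, this, hr, ha]
  · have h0 : ∑ a, ((k n a : ℝ) - n * W a) = 0 := by
      rw [Finset.sum_sub_distrib, ← Finset.mul_sum, hW.2, mul_one, ← Nat.cast_sum, hksum, sub_self]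
    have h1 : ∑ a, ((k n a : ℝ) - n * W a) * (u a - u a₀) ≤ 0 := by
      refine Finset.sum_nonpos fun a _ => ?_
      by_cases h : a = a₀
      · simp [h]
      · by_cases hWa : W a = 0
        · simp [hk, h, hr, hWa]
        · refine mul_nonpos_of_nonpos_of_nonneg ?_
            (sub_nonneg.2 (hmin a (Finset.mem_filter.2 ⟨Finset.mem_univ _, hWa⟩)))
          rw [hk₁ n a (Finset.mem_erase.2 ⟨h, Finset.mem_univ _⟩)]
          exact sub_nonpos.2 (hrle n a)
    simp only [mul_sub] at h1
    rw [Finset.sum_sub_distrib, ← Finset.sum_mul, h0, zero_mul, sub_zero] at h1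
    simp only [sub_mul, mul_assoc] at h1
    rw [Finset.sum_sub_distrib, ← Finset.mul_sum] at h1
    exact sub_nonpos.1 h1
  · have hlim : ∀ a, Tendsto (fun n => (r n a : ℝ) / n) atTop (𝓝 (W a)) := fun a => by
      have := (tendsto_nat_floor_mul_div_atTop (hW.1 a)).comp
        (tendsto_natCast_atTop_atTop (R := ℝ))
      simpa only [hr, Function.comp_def, mul_comm] using this
    refine tendsto_pi_nhds.2 fun a => ?_
    by_cases h : a = a₀
    · subst h
      have h1 : Tendsto (fun n : ℕ => 1 - ∑ b ∈ Finset.univ.erase a, (r n b : ℝ) / n) atTop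
          (𝓝 (1 - ∑ b ∈ Finset.univ.erase a, W b)) :=
        tendsto_const_nhds.sub (tendsto_finsetSum _ fun b _ => hlim b)
      have h2 : 1 - ∑ b ∈ Finset.univ.erase a, W b = W a := by
        rw [← hW.2, hsplit W, add_sub_cancel_right]
      rw [h2] at h1
      refine h1.congr' ?_
      filter_upwards [eventually_ne_atTop 0] with n hn
      rw [hk₀, Nat.cast_sub (hrsum n), sub_div, div_self (Nat.cast_ne_zero.2 hn), Nat.cast_sum,
        Finset.sum_div]
    · refine (hlim a).congr fun n => ?_
      rw [hk₁ n a (Finset.mem_erase.2 ⟨h, Finset.mem_univ _⟩)]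

/-- Rounding keeps the support and does not raise the cost, so the constraint at `Δ` holds exactly
for every `n ≠ 0` and no continuity in `Δ` is needed. -/
theorem exists_sequence_tendsto {p : X → ℝ} (hp0 : ∀ x, 0 ≤ p x) {d : X → Z → ℝ} {Δ : ℝ}
    {W : X × Z → ℝ} (hW : W ∈ feasible p d Δ) :
    ∃ s : (n : ℕ) → Fin n → X × Z, (∀ n i, 0 < p (s n i).1) ∧
      (∀ n, n ≠ 0 → avgDist d (fun i => (s n i).1) (fun i => (s n i).2) ≤ Δ) ∧
      Tendsto (fun n => empirical (s n)) atTop (𝓝 W) := by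
  obtain ⟨k, hsum, hsupp, hcost, hlim⟩ := exists_counts_tendsto hW.1 fun w => d w.1 w.2
  choose s hs using fun n => exists_count_eq (k n) (hsum n)
  refine ⟨s, fun n i => ?_, fun n hn => ?_, ?_⟩
  · refine (hp0 _).lt_of_ne' fun h => ?_
    have hWi : W (s n i) = 0 :=
      le_antisymm ((le_fstMarginal hW.1.1 (s n i).1 (s n i).2).trans (hW.2.1 _ h).le) (hW.1.1 _)
    have := empirical_apply_pos (s n) i
    simp [empirical, hs, hsupp n _ hWi] at this
  · have hn' : (0 : ℝ) < n := Nat.cast_pos.2 (Nat.pos_of_ne_zero hn)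
    have h1 := sum_comp_eq_sum_count (s n) fun w => d w.1 w.2
    rw [hs] at h1
    have h2 := hcost n
    rw [← h1] at h2
    rw [avgDist, one_div, inv_mul_le_iff₀ hn']
    exact h2.trans (mul_le_mul_of_nonneg_left hW.2.2 hn'.le)
  · refine hlim.congr fun n => ?_
    funext a
    rw [empirical, hs]

end Achievability

/-! ### Bounds for the optimal code, equal up to a polynomial factor. -/

section Main

theorem numMessages_le (n : ℕ) (R : ℝ) : (numMessages n R : ℝ) ≤ 2 ^ ((n : ℝ) * R) :=
  Nat.floor_le (by positivity)

/-- Since `R ≥ 0` the floor is at least 1, and a real number below `⌊t⌋ + 1` is then below `2⌊t⌋`.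
-/
theorem le_numMessages (n : ℕ) {R : ℝ} (hR : 0 ≤ R) :
    2 ^ ((n : ℝ) * R) / 2 ≤ (numMessages n R : ℝ) := by
  have h1 : (1 : ℝ) ≤ 2 ^ ((n : ℝ) * R) :=
    Real.one_le_rpow one_le_two (mul_nonneg (Nat.cast_nonneg n) hR)
  have h2 : (1 : ℝ) ≤ numMessages n R := Nat.one_le_cast.2 (Nat.one_le_floor_iff _ |>.2 h1)
  have h3 : (2 : ℝ) ^ ((n : ℝ) * R) < numMessages n R + 1 := Nat.lt_floor_add_one _
  linarith

variable {X Z : Type*} [Fintype X] [Fintype Z]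

theorem correctProb_le_maxCorrectProb {P : X × X → ℝ} {d : X → Z → ℝ} {R Δ : ℝ} {n : ℕ}
    (f : (Fin n → X) → Fin (numMessages n R)) (g : Fin (numMessages n R) → Fin n → Z) :
    correctProb P d Δ f g ≤ maxCorrectProb P d n R Δ :=
  le_ciSup (f := fun c : ((Fin n → X) → Fin (numMessages n R)) ×
    (Fin (numMessages n R) → (Fin n → Z)) => correctProb P d Δ c.1 c.2)
    (Set.finite_range _).bddAbove (f, g)

/-- The deterministic channel of a map `φ` attaining `minDist` is admissible for the source law
itself. -/
theorem feasible_nonempty [Nonempty Z] {P : X × X → ℝ} (hP : P ∈ stdSimplex ℝ (X × X))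
    (hdiag : ∀ x y, x ≠ y → P (x, y) = 0) {d : X → Z → ℝ} {Δ : ℝ} (hΔ : minDist P d ≤ Δ) :
    (feasible (fstMarginal P) d Δ).Nonempty := by
  classical
  obtain ⟨φ, hφ⟩ := exists_eq_ciInf_of_finite
    (f := fun φ : X → Z => ∑ x, ∑ y, P (x, y) * d x (φ y))
  refine ⟨_, jointPmf_mem_feasible (V := fun x => Pi.single (φ x) 1)
    (fstMarginal_mem_stdSimplex hP) ⟨fun x => single_mem_stdSimplex ℝ (φ x), ?_⟩ fun x h => h⟩
  refine le_trans (le_of_eq ?_) (hφ.trans_le hΔ)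
  refine Finset.sum_congr rfl fun x _ => ?_
  rw [Finset.sum_eq_single (φ x) (fun z _ hz => by simp [jointPmf, hz]) (by simp),
    Finset.sum_eq_single x (fun y _ hy => by simp [hdiag x y hy.symm]) (by simp)]
  simp [jointPmf, fstMarginal_of_diagonal hdiag]

theorem le_maxCorrectProb {P : X × X → ℝ} (hP : ∀ w, 0 ≤ P w)
    (hdiag : ∀ x y, x ≠ y → P (x, y) = 0) {d : X → Z → ℝ} {R Δ : ℝ} (hR : 0 ≤ R) {n : ℕ}
    {s : Fin n → X × Z} (hp : ∀ i, 0 < fstMarginal P (s i).1)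
    (hd : avgDist d (fun i => (s i).1) (fun i => (s i).2) ≤ Δ) :
    2 ^ (-((n : ℝ) * jointExponent (fstMarginal P) R (empirical s))) /
      (4 * ((n : ℝ) + 1) ^ (Fintype.card X + Fintype.card (X × Z))) ≤
      maxCorrectProb P d n R Δ := by
  obtain ⟨f, g, h⟩ := exists_le_correctProb hP hdiag hp hd (le_numMessages n hR)
  exact h.trans (correctProb_le_maxCorrectProb f g)

theorem maxCorrectProb_le [Nonempty Z] {P : X × X → ℝ} (hP : ∀ w, 0 ≤ P w)
    (hdiag : ∀ x y, x ≠ y → P (x, y) = 0) {n : ℕ} (hn : n ≠ 0) {d : X → Z → ℝ} {R Δ E : ℝ}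
    (hR : 0 ≤ R)
    (hE : ∀ W ∈ feasible (fstMarginal P) d Δ, E ≤ jointExponent (fstMarginal P) R W) :
    maxCorrectProb P d n R Δ ≤ 2 ^ (-((n : ℝ) * E)) *
      (4 * ((n : ℝ) + 1) ^ (Fintype.card X + Fintype.card (X × Z))) := by
  have hM : 0 < numMessages n R := by
    have : (0 : ℝ) < numMessages n R := lt_of_lt_of_le (by positivity) (le_numMessages n hR)
    exact_mod_cast this
  have : Nonempty (Fin (numMessages n R)) := ⟨⟨0, hM⟩⟩
  refine ciSup_le fun c => (correctProb_le hP hdiag hn hE c.1 c.2).trans ?_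
  have hn1 : (1 : ℝ) ≤ (n : ℝ) + 1 := by
    have : (0 : ℝ) ≤ n := Nat.cast_nonneg n
    linarith
  have h1 : ((n : ℝ) + 1) ^ Fintype.card X ≤
      ((n : ℝ) + 1) ^ (Fintype.card X + Fintype.card (X × Z)) :=
    pow_le_pow_right₀ hn1 (Nat.le_add_right _ _)
  have h2 : ((n : ℝ) + 1) ^ Fintype.card (X × Z) ≤
      ((n : ℝ) + 1) ^ (Fintype.card X + Fintype.card (X × Z)) :=
    pow_le_pow_right₀ hn1 (Nat.le_add_left _ _)
  have h3 : 2 ^ (-((n : ℝ) * R)) * (numMessages n R : ℝ) ≤ 1 := by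
    calc 2 ^ (-((n : ℝ) * R)) * (numMessages n R : ℝ)
        ≤ 2 ^ (-((n : ℝ) * R)) * 2 ^ ((n : ℝ) * R) := by
          gcongr
          exact numMessages_le n R
      _ = 1 := by rw [← Real.rpow_add two_pos, neg_add_cancel, Real.rpow_zero]
  have h4 := mul_le_mul_of_nonneg_right h3
    (by positivity : 0 ≤ ((n : ℝ) + 1) ^ Fintype.card (X × Z))
  have h5 : (0 : ℝ) ≤ ((n : ℝ) + 1) ^ (Fintype.card X + Fintype.card (X × Z)) := by positivity
  -- A factor 2 would suffice; 4 makes the polynomial the same as in the lower bound.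
  refine mul_le_mul_of_nonneg_left ?_ (by positivity)
  rw [← mul_assoc]
  linarith

theorem tendsto_logb_polynomial_div (c : ℕ) :
    Tendsto (fun n : ℕ => 1 / (n : ℝ) * Real.logb 2 (4 * ((n : ℝ) + 1) ^ c)) atTop (𝓝 0) := by
  have h1 : Tendsto (fun n : ℕ => Real.log ((n : ℝ) + 1) / n) atTop (𝓝 0) := by
    have := (Real.tendsto_pow_log_div_mul_add_atTop 1 (-1) 1 one_ne_zero).comp
      (tendsto_atTop_add_const_right _ (1 : ℝ) (tendsto_natCast_atTop_atTop (R := ℝ)))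
    simpa [Function.comp_def] using this
  have h2 : Tendsto (fun n : ℕ => 1 / (n : ℝ)) atTop (𝓝 0) := tendsto_one_div_atTop_nhds_zero_nat
  have h3 := (h2.mul_const (Real.logb 2 4)).add (h1.mul_const ((c : ℝ) / Real.log 2))
  simp only [zero_mul, add_zero] at h3
  refine h3.congr fun n => ?_
  rw [Real.logb_mul (by norm_num) (by positivity), Real.logb_pow, Real.logb, Real.logb]
  ring

end Main

end RemoteLossy

end

/-! ### The limit, by squeezing. -/

open RemoteLossy

theorem corollary2 {X Z : Type*} [Fintype X] [DecidableEq X] [Fintype Z] [Nonempty Z]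
    (P : X × X → ℝ) (hP : P ∈ stdSimplex ℝ (X × X))
    (hXY : ∑ p : X × X, (if p.1 = p.2 then P p else 0) = 1)
    (d : X → Z → ℝ) (hd : ∀ x z, 0 ≤ d x z)
    (R Δ : ℝ) (hR : 0 ≤ R) (hΔ : RemoteLossy.minDist P d ≤ Δ) :
    -- the minimum defining the rate-distortion function is attained
    (∀ Q ∈ stdSimplex ℝ X, (RemoteLossy.testChannels Q d Δ).Nonempty →
      ∃ V ∈ RemoteLossy.testChannels Q d Δ,
        RemoteLossy.rateDist Q d Δ =
          ((RemoteLossy.mutualInfo (RemoteLossy.jointPmf Q V) : ℝ) : EReal)) ∧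
    -- the logarithm in the exponent is finite
    (∀ n : ℕ, 1 ≤ n → 0 < RemoteLossy.maxCorrectProb P d n R Δ) ∧
    -- the exponent exists and equals the stated minimum
    ∃ E : ℝ,
      Tendsto (fun n : ℕ => -(1 / (n : ℝ)) * Real.logb 2 (RemoteLossy.maxCorrectProb P d n R Δ))
        atTop (𝓝 E) ∧
      IsLeast
        ((fun Q : X → ℝ => RemoteLossy.relEntropy Q (RemoteLossy.fstMarginal P) +
            max 0 (RemoteLossy.rateDist Q d Δ - (R : EReal))) '' stdSimplex ℝ X)
        (E : EReal) := by
  have hdiag : ∀ x y, x ≠ y → P (x, y) = 0 := fun x y h => eq_zero_of_diagonal hP hXY h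
  obtain ⟨W, hW, hmin⟩ := (isCompact_feasible (fstMarginal P) d Δ).exists_isMinOn
    (feasible_nonempty hP hdiag hΔ) (continuousOn_jointExponent (fstMarginal P) d R Δ)
  have hmin' : ∀ W' ∈ feasible (fstMarginal P) d Δ,
      jointExponent (fstMarginal P) R W ≤ jointExponent (fstMarginal P) R W' := fun W' h => hmin h
  obtain ⟨s, hsp, hsd, hs⟩ := exists_sequence_tendsto (fstMarginal_nonneg hP.1) hW
  set c := Fintype.card X + Fintype.card (X × Z) with hc
  have hlow : ∀ n : ℕ, n ≠ 0 →
      2 ^ (-((n : ℝ) * jointExponent (fstMarginal P) R (empirical (s n)))) /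
        (4 * ((n : ℝ) + 1) ^ c) ≤ maxCorrectProb P d n R Δ := fun n hn =>
    le_maxCorrectProb hP.1 hdiag hR (hsp n) (hsd n hn)
  have hpos : ∀ n : ℕ, n ≠ 0 → 0 < maxCorrectProb P d n R Δ := fun n hn =>
    lt_of_lt_of_le (by positivity) (hlow n hn)
  refine ⟨fun Q hQ hne => exists_rateDist_eq hQ d Δ hne,
    fun n hn => hpos n (Nat.one_le_iff_ne_zero.1 hn),
    jointExponent (fstMarginal P) R W, ?_, isLeast_jointExponent hW hmin'⟩
  have hF : Tendsto (fun n => jointExponent (fstMarginal P) R (empirical (s n))) atTop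
      (𝓝 (jointExponent (fstMarginal P) R W)) := by
    -- Continuity is known only within `feasible`, so the approximating types must eventually lie in
    -- that set.
    refine (continuousOn_jointExponent (fstMarginal P) d R Δ W hW).tendsto.comp
      (tendsto_nhdsWithin_iff.2 ⟨hs, ?_⟩)
    filter_upwards [eventually_ne_atTop 0] with n hn
    exact empirical_mem_feasible hn (fun i => (hsp n i).ne') (hsd n hn)
  have hlog := tendsto_logb_polynomial_div c
  have hl1 := (tendsto_const_nhds (x := jointExponent (fstMarginal P) R W)).sub hlog
  have hl2 := hF.add hlog
  rw [sub_zero] at hl1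
  rw [add_zero] at hl2
  have hscale : ∀ n : ℕ, n ≠ 0 → ∀ a b : ℝ, 1 / (n : ℝ) * (n * a + b) = a + 1 / (n : ℝ) * b :=
    fun n hn a b => by
      have : (n : ℝ) ≠ 0 := Nat.cast_ne_zero.2 hn
      field_simp
  refine tendsto_of_tendsto_of_tendsto_of_le_of_le' hl1 hl2 ?_ ?_
  · filter_upwards [eventually_ne_atTop 0] with n hn
    have h := Real.logb_le_logb_of_le one_lt_two (hpos n hn)
      (maxCorrectProb_le hP.1 hdiag hn hR hmin')
    rw [Real.logb_mul (by positivity) (by positivity), Real.logb_rpow two_pos (by norm_num)] at h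
    have h2 := mul_le_mul_of_nonneg_left h (by positivity : 0 ≤ 1 / (n : ℝ))
    rw [← mul_neg, hscale n hn] at h2
    linarith
  · filter_upwards [eventually_ne_atTop 0] with n hn
    have h := Real.logb_le_logb_of_le one_lt_two (by positivity) (hlow n hn)
    rw [Real.logb_div (by positivity) (by positivity), Real.logb_rpow two_pos (by norm_num)] at h
    have h2 := mul_le_mul_of_nonneg_left h (by positivity : 0 ≤ 1 / (n : ℝ))
    rw [← mul_neg, sub_eq_add_neg, hscale n hn] at h2
    linarith
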